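/- **The language.** Terms are built from variables and the constants $\mathsf k,\mathsf s,\mathsf p,\mathsf p_0,\mathsf p_1,\mathsf c_{\mathsf W},\epsilon,\mathsf s_0,\mathsf s_1,\mathsf p_{\mathsf W},\mathsf s_\ell,\mathsf p_\ell,\mathsf c_\subseteq,*,\times$ by binary (total) application, written by juxtaposition. Formulas are built from the atoms $\mathsf W(t)$ and $s=t$ by $\neg,\wedge,\vee,\to,\forall,\exists$; a formula is *positive* if it contains neither $\neg$ nor $\to$, and *$\mathsf W$-free* if $\mathsf W$ does not occur in it. Put $0:=\mathsf s_0\epsilon$, $1:=\mathsf s_1\epsilon$, $s*t:=*\,s\,t$, $s\times t:=\times\,s\,t$, $s\subseteq t:=(\mathsf c_\subseteq\,s\,t=0)$, $s\le t:=(1\times s\subseteq 1\times t)$. Let $\mathsf c_\succeq$ be a closed term, fixed throughout; put $s\succeq t:=(\mathsf c_\succeq\,s\,t=0)$ and $\exists z\succeq t.\,\phi:=\exists z.\,\mathsf W(z)\wedge (z\succeq t\wedge\phi)$. (In the intended theory $\mathsf c_\succeq$ represents the relation $v\succeq w$ on binary words: $|w|<|v|$, or $|w|=|v|$ and $w$ is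 bitwise at most $v$. The statement below holds for every closed term $\mathsf c_\succeq$.) **The calculus $\mathsf{APH}^+$.** Sequents $\Gamma\Rightarrow\Delta$ consist of two finite sequences of formulas. The rules are those of Gentzen's classical sequent calculus (identity, weakening, exchange, contraction, cut, left and right rules for $\neg,\wedge,\vee,\to,\forall,\exists$), together with the following, for all terms and all side formulas $\Gamma,\Delta$ (an axiom $\Gamma_0\Rightarrow\Delta_0$ stands for all sequents $\Gamma,\Gamma_0\Rightarrow\Delta_0,\Delta$). 1. Equality: $\Rightarrow t=t$; $\ s=t\Rightarrow t=s$; $\ q=s,\,s=t\Rightarrow q=t$; $\ s=s',\,t=t'\Rightarrow s\,t=s'\,t'$; $\ s=t,\,\mathsf W(s)\Rightarrow\mathsf W(t)$. 2. Combinators, pairing: $\Rightarrow\mathsf k\,x\,y=x$; $\ \Rightarrow\mathsf s\,x\,y\,z=x\,z\,(y\,z)$; $\ \Rightarrow\mathsf p_0(\mathsf p\,x\,y)=x\wedge\mathsf p_1(\mathsf p\,x\,y)=y$. 3. Cases: $\Rightarrow\mathsf c_{\mathsf W}\,\epsilon\,s\,r\,u=s$; $\ \mathsf W(t)\Rightarrow\mathsf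 c_{\mathsf W}(\mathsf s_0t)\,s\,r\,u=r$; $\ \mathsf W(t)\Rightarrow\mathsf c_{\mathsf W}(\mathsf s_1t)\,s\,r\,u=u$. 4. Binary successors and predecessor: $\Rightarrow\mathsf W(\epsilon)$; $\ \mathsf W(x)\Rightarrow\mathsf W(\mathsf s_0x)\wedge\mathsf W(\mathsf s_1x)$; $\ \mathsf s_0x=\mathsf s_1x\Rightarrow$; $\ \mathsf s_0x=\epsilon\Rightarrow$; $\ \mathsf s_1x=\epsilon\Rightarrow$; $\ \mathsf W(x)\Rightarrow\mathsf W(\mathsf p_{\mathsf W}x)$; $\ \Rightarrow\mathsf p_{\mathsf W}\epsilon=\epsilon$; $\ \mathsf W(x)\Rightarrow\mathsf p_{\mathsf W}(\mathsf s_0x)=x\wedge\mathsf p_{\mathsf W}(\mathsf s_1x)=x$; $\ \mathsf W(x)\Rightarrow x=\epsilon,\ \mathsf s_0(\mathsf p_{\mathsf W}x)=x\vee\mathsf s_1(\mathsf p_{\mathsf W}x)=x$. 5. Lexicographic successor and predecessor: $\mathsf W(x)\Rightarrow\mathsf W(\mathsf s_\ell x)$; $\ \Rightarrow\mathsf s_\ell\epsilon=0$;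 $\ \mathsf W(x)\Rightarrow\mathsf s_\ell(\mathsf s_0x)=\mathsf s_1x\wedge\mathsf s_\ell(\mathsf s_1x)=\mathsf s_0(\mathsf s_\ell x)$; $\ \mathsf W(x)\Rightarrow\mathsf W(\mathsf p_\ell x)$; $\ \Rightarrow\mathsf p_\ell\epsilon=\epsilon$; $\ \mathsf W(x)\Rightarrow\mathsf p_\ell(\mathsf s_\ell x)=x$; $\ \mathsf W(x)\Rightarrow x=\epsilon,\ \mathsf s_\ell(\mathsf p_\ell x)=x$. 6. Initial subwords: $\mathsf W(x),\mathsf W(y)\Rightarrow\mathsf c_\subseteq x\,y=0\vee\mathsf c_\subseteq x\,y=1$; $\ \mathsf W(x),\,x\subseteq\epsilon\Rightarrow x=\epsilon$; $\ \mathsf W(x),\,x=\epsilon\Rightarrow x\subseteq\epsilon$; $\ \mathsf W(x),\mathsf W(y),\,x\subseteq y\Rightarrow y=\epsilon,\ x\subseteq\mathsf p_{\mathsf W}y\vee x=y$; $\ \mathsf W(x),\mathsf W(y),\,x\subseteq\mathsf p_{\mathsf W}y\vee x=y\Rightarrow y=\epsilon,\ x\subseteq y$; $\ \mathsf W(x),\mathsf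 W(y),\mathsf W(z),\,x\subseteq y,\,y\subseteq z\Rightarrow x\subseteq z$. 7. Concatenation: $\mathsf W(x),\mathsf W(y)\Rightarrow\mathsf W(x*y)$; $\ \mathsf W(x)\Rightarrow x*\epsilon=x$; $\ \mathsf W(x),\mathsf W(y)\Rightarrow x*(\mathsf s_0y)=\mathsf s_0(x*y)\wedge x*(\mathsf s_1y)=\mathsf s_1(x*y)$. 8. Multiplication: $\mathsf W(x),\mathsf W(y)\Rightarrow\mathsf W(x\times y)$; $\ \mathsf W(x)\Rightarrow x\times\epsilon=\epsilon$; $\ \mathsf W(x),\mathsf W(y)\Rightarrow x\times(\mathsf s_0y)=(x\times y)*x\wedge x\times(\mathsf s_1y)=(x\times y)*x$. 9. Induction on notation, for $\phi(y)$ of the form $\exists x.\,\mathsf W(x)\wedge(x\le t\,y\wedge\psi(t,y,x))$ with $\psi$ positive and $\mathsf W$-free: from $\Gamma,\mathsf W(u)\Rightarrow\mathsf W(t\,u),\Delta$, from $\Gamma\Rightarrow\phi(\epsilon),\Delta$, and from $\Gamma,\mathsf W(u),\phi(u)\Rightarrow\phi(\mathsf s_iu),\Delta$ for $i=0,1$,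 infer $\Gamma,\mathsf W(s)\Rightarrow\phi(s),\Delta$. 10. Monotone induction, for $\phi(y,x)$ of the form $x\le t\,y\wedge\psi(t,y,x)$ with $\psi$ positive, $\mathsf W$-free and without disjunctions: from $\Gamma,\mathsf W(u)\Rightarrow\mathsf W(t\,u),\Delta$, from $\Gamma\Rightarrow\exists n.\,\mathsf W(n)\wedge\phi(\epsilon,n),\Delta$, and from $\Gamma,\mathsf W(a),\mathsf W(b),\phi(a,b)\Rightarrow\exists m\succeq b.\,\phi(\mathsf s_\ell a,m),\Delta$, infer $\Gamma,\mathsf W(s)\Rightarrow\exists n.\,\mathsf W(n)\wedge\phi(s,n),\Delta$. In 9 and 10, $s,t$ are arbitrary terms, $\psi$ may contain further free variables, and $u,a,b$ are eigenvariables ($a\neq b$), i.e. they do not occur in the conclusion of the rule, nor in the term $t$ or among the further free variables of $\psi$. **Corollary.** Let $\Gamma\Rightarrow\Delta$ be a sequent in which all formulas are positive. If $\Gamma\Rightarrow\Delta$ is derivable in $\mathsf{APH}^+$, then there is an $\mathsf{APH}^+$ derivation of $\Gamma\Rightarrow\Delta$ in which all formulas of all sequents are positive. -/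

import Mathlib

namespace APH

/-- The individual constants of the applicative language. -/
inductive Cst : Type
  | k | s
  | p | p0 | p1
  | cW
  | eps
  | s0 | s1
  | pW
  | sl | pl
  | csub
  | conc
  | mult

/-- Terms, built from variables and constants by (total) term application.
Variables are de Bruijn indices: inside a formula, `var n` refers to the `n`-th enclosing
quantifier, counted from the inside, and an index that exceeds the number `q` of enclosing
quantifiers is the free variable with number `n - q`. -/
inductive Term : Type
  | var : ℕ → Term
  | cst : Cst → Term
  | app : Term → Term → Term

infixl:80 " ⬝ " => Term.app

namespace Term

/-- Simultaneous substitution of terms for variables. -/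
def subst (σ : ℕ → Term) : Term → Term
  | var n => σ n
  | cst c => cst c
  | app r t => app (subst σ r) (subst σ t)

/-- Renaming of all variables `n` to `n + 1`, so that the variable `0` becomes fresh. -/
def shift (t : Term) : Term := t.subst (fun n => var (n + 1))

/-- A term is closed if no variable occurs in it. -/
def Closed : Term → Prop
  | var _ => False
  | cst _ => True
  | app r t => Closed r ∧ Closed t

end Term

/-- The empty word `ε`. -/
def eps : Term := Term.cst Cst.eps

/-- `s₀ t`. -/
def S0 (t : Term) : Term := Term.cst Cst.s0 ⬝ t

/-- `s₁ t`. -/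
def S1 (t : Term) : Term := Term.cst Cst.s1 ⬝ t

/-- Binary predecessor `p_W t`. -/
def P (t : Term) : Term := Term.cst Cst.pW ⬝ t

/-- Lexicographic successor `s_ℓ t`. -/
def SL (t : Term) : Term := Term.cst Cst.sl ⬝ t

/-- Lexicographic predecessor `p_ℓ t`. -/
def PL (t : Term) : Term := Term.cst Cst.pl ⬝ t

/-- `0 := s₀ ε`. -/
def zero : Term := S0 eps

/-- `1 := s₁ ε`. -/
def one : Term := S1 eps

/-- Word concatenation `r * t`. -/
def conc (r t : Term) : Term := Term.cst Cst.conc ⬝ r ⬝ t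

/-- Word multiplication `r × t`. -/
def mult (r t : Term) : Term := Term.cst Cst.mult ⬝ r ⬝ t

/-- `c_W t r₁ r₂ r₃`. -/
def cases (t r₁ r₂ r₃ : Term) : Term := Term.cst Cst.cW ⬝ t ⬝ r₁ ⬝ r₂ ⬝ r₃

/-- `c_⊆ r t`. -/
def csub (r t : Term) : Term := Term.cst Cst.csub ⬝ r ⬝ t

/-- First-order formulas over the atoms `W(t)` and `r = t`. -/
inductive Formula : Type
  | W : Term → Formula
  | eq : Term → Term → Formula
  | neg : Formula → Formula
  | and : Formula → Formula → Formula
  | or : Formula → Formula → Formula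
  | imp : Formula → Formula → Formula
  | all : Formula → Formula
  | ex : Formula → Formula

/-- The substitution used below a quantifier: the bound variable `0` is kept. -/
def up (σ : ℕ → Term) : ℕ → Term
  | 0 => Term.var 0
  | n + 1 => (σ n).shift

namespace Formula

/-- Simultaneous, capture-avoiding substitution of terms for free variables. -/
def subst : (ℕ → Term) → Formula → Formula
  | σ, W t => W (t.subst σ)
  | σ, eq r t => eq (r.subst σ) (t.subst σ)
  | σ, neg A => neg (subst σ A)
  | σ, and A B => and (subst σ A) (subst σ B)
  | σ, or A B => or (subst σ A) (subst σ B)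
  | σ, imp A B => imp (subst σ A) (subst σ B)
  | σ, all A => all (subst (up σ) A)
  | σ, ex A => ex (subst (up σ) A)

/-- Renaming of all free variables `n` to `n + 1`, so that the variable `0` becomes fresh. -/
def shift (A : Formula) : Formula := A.subst (fun n => Term.var (n + 1))

/-- `A.inst t` is `A(t)` for `A = A(x)`, where `x` is the variable `0` and the other free
variables are renumbered from `n + 1` to `n`. It turns the body of `∀ x. A` or `∃ x. A` into
its instance at `t`. -/
def inst (A : Formula) (t : Term) : Formula :=
  A.subst (fun n => match n with
    | 0 => t
    | n + 1 => Term.var n)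

/-- Positive formulas: those without negation and implication. -/
def Positive : Formula → Prop
  | W _ => True
  | eq _ _ => True
  | neg _ => False
  | and A B => Positive A ∧ Positive B
  | or A B => Positive A ∧ Positive B
  | imp _ _ => False
  | all A => Positive A
  | ex A => Positive A

/-- The predicate `W` does not occur in the formula. -/
def WFree : Formula → Prop
  | W _ => False
  | eq _ _ => True
  | neg A => WFree A
  | and A B => WFree A ∧ WFree B
  | or A B => WFree A ∧ WFree B
  | imp A B => WFree A ∧ WFree B
  | all A => WFree A
  | ex A => WFree A

/-- The formula contains no disjunction. -/
def DisjFree : Formula → Prop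
  | W _ => True
  | eq _ _ => True
  | neg A => DisjFree A
  | and A B => DisjFree A ∧ DisjFree B
  | or _ _ => False
  | imp A B => DisjFree A ∧ DisjFree B
  | all A => DisjFree A
  | ex A => DisjFree A

/-- `r ⊆ t := (c_⊆ r t = 0)`. -/
def sub (r t : Term) : Formula := eq (csub r t) zero

/-- `r ≤ t := (1 × r ⊆ 1 × t)`. -/
def le (r t : Term) : Formula := sub (mult one r) (mult one t)

/-- `r ⪰ t := (c_⪰ r t = 0)`, where `c` is the term `c_⪰`. -/
def geq (c r t : Term) : Formula := eq (c ⬝ r ⬝ t) zero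

/-- The formula `φ(y, x) = (x ≤ t y ∧ ψ(t, y, x))`: here `x` is the variable `0`, `y` is the
variable `1`, and `t` is a term in which neither `x` nor `y` occurs. -/
def bounded (t : Term) (ψ : Formula) : Formula :=
  and (le (Term.var 0) (t.shift.shift ⬝ Term.var 1)) ψ

/-- The formula `∃ x ≤ t y. ψ(t, y, x)`, that is, `∃ x. W(x) ∧ (x ≤ t y ∧ ψ(t, y, x))`:
its variable `0` is `y`. -/
def boundedEx (t : Term) (ψ : Formula) : Formula :=
  ex (and (W (Term.var 0)) (bounded t ψ))

/-- The formula `∃ z ⪰ x. φ(s_ℓ y, z)`, that is, `∃ z. W(z) ∧ (z ⪰ x ∧ φ(s_ℓ y, z))`, where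
`φ = bounded t ψ`: its variable `0` is `x` and its variable `1` is `y` (so that below the
quantifier `z`, `x`, `y` are the variables `0`, `1`, `2`). -/
def monotoneStep (c t : Term) (ψ : Formula) : Formula :=
  ex (and (W (Term.var 0))
    (and (geq c (Term.var 0) (Term.var 1))
      ((bounded t ψ).subst (fun n => match n with
        | 0 => Term.var 0
        | 1 => SL (Term.var 2)
        | n + 2 => Term.var (n + 3)))))

end Formula

/-- A sequent `Γ ⇒ Δ` of finite sequences of formulas. -/
structure Sequent : Type where
  ant : List Formula
  suc : List Formula

infix:45 " ⟹ " => Sequent.mk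

/-- All formulas of the sequent are positive. -/
def Sequent.Positive (S : Sequent) : Prop :=
  (∀ A ∈ S.ant, A.Positive) ∧ (∀ A ∈ S.suc, A.Positive)

/-- All free variables of the formulas of a sequence are renamed from `n` to `n + 1`, so that
`0` does not occur in it: this makes `0` an eigenvariable. -/
def shiftAll (Γ : List Formula) : List Formula := Γ.map Formula.shift

open Formula in
/-- The non-logical axioms, without side formulas, for arbitrary terms: first the axioms of
equality, then those of the basic theory of operations and words. Every formula is positive:
hypotheses and negated formulas of an axiom move to the other side of the sequent. -/
inductive Ax : List Formula → List Formula → Prop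
  -- equality
  | eq_refl (t : Term) : Ax [] [eq t t]
  | eq_symm (r t : Term) : Ax [eq r t] [eq t r]
  | eq_trans (q r t : Term) : Ax [eq q r, eq r t] [eq q t]
  | eq_app (r r' t t' : Term) : Ax [eq r r', eq t t'] [eq (r ⬝ t) (r' ⬝ t')]
  | eq_W (r t : Term) : Ax [eq r t, W r] [W t]
  -- combinatory algebra and pairing
  | k (x y : Term) : Ax [] [eq (Term.cst Cst.k ⬝ x ⬝ y) x]
  | s (x y z : Term) : Ax [] [eq (Term.cst Cst.s ⬝ x ⬝ y ⬝ z) (x ⬝ z ⬝ (y ⬝ z))]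
  | pair (x y : Term) : Ax []
      [and (eq (Term.cst Cst.p0 ⬝ (Term.cst Cst.p ⬝ x ⬝ y)) x)
        (eq (Term.cst Cst.p1 ⬝ (Term.cst Cst.p ⬝ x ⬝ y)) y)]
  -- definition by cases on `W`
  | cases_eps (r₁ r₂ r₃ : Term) : Ax [] [eq (cases eps r₁ r₂ r₃) r₁]
  | cases_S0 (t r₁ r₂ r₃ : Term) : Ax [W t] [eq (cases (S0 t) r₁ r₂ r₃) r₂]
  | cases_S1 (t r₁ r₂ r₃ : Term) : Ax [W t] [eq (cases (S1 t) r₁ r₂ r₃) r₃]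
  -- closure, binary successors, and predecessor
  | W_eps : Ax [] [W eps]
  | W_succ (x : Term) : Ax [W x] [and (W (S0 x)) (W (S1 x))]
  | S0_ne_S1 (x : Term) : Ax [eq (S0 x) (S1 x)] []
  | S0_ne_eps (x : Term) : Ax [eq (S0 x) eps] []
  | S1_ne_eps (x : Term) : Ax [eq (S1 x) eps] []
  | W_P (x : Term) : Ax [W x] [W (P x)]
  | P_eps : Ax [] [eq (P eps) eps]
  | P_succ (x : Term) : Ax [W x] [and (eq (P (S0 x)) x) (eq (P (S1 x)) x)]
  | succ_P (x : Term) : Ax [W x] [eq x eps, or (eq (S0 (P x)) x) (eq (S1 (P x)) x)]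
  -- lexicographic successor and predecessor
  | W_SL (x : Term) : Ax [W x] [W (SL x)]
  | SL_eps : Ax [] [eq (SL eps) zero]
  | SL_succ (x : Term) : Ax [W x] [and (eq (SL (S0 x)) (S1 x)) (eq (SL (S1 x)) (S0 (SL x)))]
  | W_PL (x : Term) : Ax [W x] [W (PL x)]
  | PL_eps : Ax [] [eq (PL eps) eps]
  | PL_SL (x : Term) : Ax [W x] [eq (PL (SL x)) x]
  | SL_PL (x : Term) : Ax [W x] [eq x eps, eq (SL (PL x)) x]
  -- initial subword relation
  | csub_values (x y : Term) : Ax [W x, W y] [or (eq (csub x y) zero) (eq (csub x y) one)]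
  | sub_eps (x : Term) : Ax [W x, sub x eps] [eq x eps]
  | eps_sub (x : Term) : Ax [W x, eq x eps] [sub x eps]
  | sub_cases (x y : Term) : Ax [W x, W y, sub x y] [eq y eps, or (sub x (P y)) (eq x y)]
  | sub_intro (x y : Term) : Ax [W x, W y, or (sub x (P y)) (eq x y)] [eq y eps, sub x y]
  | sub_trans (x y z : Term) : Ax [W x, W y, W z, sub x y, sub y z] [sub x z]
  -- word concatenation
  | W_conc (x y : Term) : Ax [W x, W y] [W (conc x y)]
  | conc_eps (x : Term) : Ax [W x] [eq (conc x eps) x]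
  | conc_succ (x y : Term) : Ax [W x, W y]
      [and (eq (conc x (S0 y)) (S0 (conc x y))) (eq (conc x (S1 y)) (S1 (conc x y)))]
  -- word multiplication
  | W_mult (x y : Term) : Ax [W x, W y] [W (mult x y)]
  | mult_eps (x : Term) : Ax [W x] [eq (mult x eps) eps]
  | mult_succ (x y : Term) : Ax [W x, W y]
      [and (eq (mult x (S0 y)) (conc (mult x y) x)) (eq (mult x (S1 y)) (conc (mult x y) x))]

open Formula in
/-- `Rule c ps S`: there is an inference of the sequent calculus with premises `ps` and
conclusion `S`. The parameter `c` is the closed term `c_⪰` through which the monotonicity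
relation is expressed; the calculus exists for every choice of it, and nothing is assumed of it.
The logical part is Gentzen's classical calculus; weakening, exchange and contraction are
merged into the one rule `struct`. -/
inductive Rule (c : Term) : List Sequent → Sequent → Prop
  | identity (Γ Δ : List Formula) (A : Formula) : Rule c [] (A :: Γ ⟹ A :: Δ)
  | struct {Γ Γ' Δ Δ' : List Formula} (hΓ : Γ ⊆ Γ') (hΔ : Δ ⊆ Δ') :
      Rule c [Γ ⟹ Δ] (Γ' ⟹ Δ')
  | cut (Γ Δ : List Formula) (A : Formula) :
      Rule c [Γ ⟹ A :: Δ, A :: Γ ⟹ Δ] (Γ ⟹ Δ)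
  | negL (Γ Δ : List Formula) (A : Formula) : Rule c [Γ ⟹ A :: Δ] (neg A :: Γ ⟹ Δ)
  | negR (Γ Δ : List Formula) (A : Formula) : Rule c [A :: Γ ⟹ Δ] (Γ ⟹ neg A :: Δ)
  | andL (Γ Δ : List Formula) (A B : Formula) :
      Rule c [A :: B :: Γ ⟹ Δ] (and A B :: Γ ⟹ Δ)
  | andR (Γ Δ : List Formula) (A B : Formula) :
      Rule c [Γ ⟹ A :: Δ, Γ ⟹ B :: Δ] (Γ ⟹ and A B :: Δ)
  | orL (Γ Δ : List Formula) (A B : Formula) :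
      Rule c [A :: Γ ⟹ Δ, B :: Γ ⟹ Δ] (or A B :: Γ ⟹ Δ)
  | orR (Γ Δ : List Formula) (A B : Formula) :
      Rule c [Γ ⟹ A :: B :: Δ] (Γ ⟹ or A B :: Δ)
  | impL (Γ Δ : List Formula) (A B : Formula) :
      Rule c [Γ ⟹ A :: Δ, B :: Γ ⟹ Δ] (imp A B :: Γ ⟹ Δ)
  | impR (Γ Δ : List Formula) (A B : Formula) :
      Rule c [A :: Γ ⟹ B :: Δ] (Γ ⟹ imp A B :: Δ)
  | allL (Γ Δ : List Formula) (A : Formula) (t : Term) :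
      Rule c [A.inst t :: Γ ⟹ Δ] (all A :: Γ ⟹ Δ)
  | allR (Γ Δ : List Formula) (A : Formula) :
      Rule c [shiftAll Γ ⟹ A :: shiftAll Δ] (Γ ⟹ all A :: Δ)
  | exL (Γ Δ : List Formula) (A : Formula) :
      Rule c [A :: shiftAll Γ ⟹ shiftAll Δ] (ex A :: Γ ⟹ Δ)
  | exR (Γ Δ : List Formula) (A : Formula) (t : Term) :
      Rule c [Γ ⟹ A.inst t :: Δ] (Γ ⟹ ex A :: Δ)
  -- non-logical axioms, with side formulas
  | ax (Γ Δ : List Formula) {Γ₀ Δ₀ : List Formula} (h : Ax Γ₀ Δ₀) :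
      Rule c [] (Γ₀ ++ Γ ⟹ Δ₀ ++ Δ)
  -- Induction on notation for `φ(y) = ∃ x ≤ t y. ψ(t, y, x)`, with `ψ` positive and `W`-free:
  -- from `Γ, W(u) ⇒ W(t u), Δ` and `Γ ⇒ φ(ε), Δ` and `Γ, W(u), φ(u) ⇒ φ(sᵢ u), Δ` (`i = 0, 1`)
  -- infer `Γ, W(r) ⇒ φ(r), Δ`; the eigenvariable `u` is the variable `0` of the premises.
  | notationInd (Γ Δ : List Formula) (t r : Term) (ψ : Formula)
      (hpos : ψ.Positive) (hW : ψ.WFree) :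
      Rule c
        [W (Term.var 0) :: shiftAll Γ ⟹ W (t.shift ⬝ Term.var 0) :: shiftAll Δ,
          Γ ⟹ (boundedEx t ψ).inst eps :: Δ,
          W (Term.var 0) :: boundedEx t ψ :: shiftAll Γ ⟹
            (boundedEx t ψ).subst (fun n => match n with
              | 0 => S0 (Term.var 0)
              | n + 1 => Term.var (n + 1)) :: shiftAll Δ,
          W (Term.var 0) :: boundedEx t ψ :: shiftAll Γ ⟹
            (boundedEx t ψ).subst (fun n => match n with
              | 0 => S1 (Term.var 0)
              | n + 1 => Term.var (n + 1)) :: shiftAll Δ]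
        (W r :: Γ ⟹ (boundedEx t ψ).inst r :: Δ)
  -- Monotone induction for `φ(y, x) = (x ≤ t y ∧ ψ(t, y, x))`, with `ψ` positive, `W`-free and
  -- without disjunctions: from `Γ, W(u) ⇒ W(t u), Δ` and `Γ ⇒ ∃ n. W(n) ∧ φ(ε, n), Δ` and
  -- `Γ, W(a), W(b), φ(a, b) ⇒ ∃ m ⪰ b. φ(s_ℓ a, m), Δ` infer
  -- `Γ, W(r) ⇒ ∃ n. W(n) ∧ φ(r, n), Δ`; the eigenvariable `u` is the variable `0` of the first
  -- premise, the eigenvariables `b`, `a` are the variables `0`, `1` of the third.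
  | monotoneInd (Γ Δ : List Formula) (t r : Term) (ψ : Formula)
      (hpos : ψ.Positive) (hW : ψ.WFree) (hdisj : ψ.DisjFree) :
      Rule c
        [W (Term.var 0) :: shiftAll Γ ⟹ W (t.shift ⬝ Term.var 0) :: shiftAll Δ,
          Γ ⟹ (boundedEx t ψ).inst eps :: Δ,
          W (Term.var 1) :: W (Term.var 0) :: bounded t ψ :: shiftAll (shiftAll Γ) ⟹
            monotoneStep c t ψ :: shiftAll (shiftAll Δ)]
        (W r :: Γ ⟹ (boundedEx t ψ).inst r :: Δ)

/-- Derivations (as trees) of a sequent. -/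
inductive Derivation (c : Term) : Sequent → Type
  | infer {ps : List Sequent} {S : Sequent} (h : Rule c ps S)
      (ds : ∀ p : Sequent, p ∈ ps → Derivation c p) : Derivation c S

/-- The formula `A` occurs in one of the sequents of the derivation. -/
def Derivation.Contains {c : Term} : {S : Sequent} → Derivation c S → Formula → Prop
  | S, .infer (ps := ps) _ ds, A =>
      A ∈ S.ant ∨ A ∈ S.suc ∨ ∃ (p : Sequent) (hp : p ∈ ps), (ds p hp).Contains A

/-- The sequent is derivable. -/
def Derivable (c : Term) (S : Sequent) : Prop := Nonempty (Derivation c S)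

end APH

/-! The proof is semantic and replaces a partial cut elimination by a forcing model. The worlds are
the positive sequents; a world counts as inconsistent when it is positively derivable. A world `q`
lies below `p` along a substitution `ρ` if it contains the `ρ`-instance of `p` (`Ext`); the
substitutions make room for eigenvariables. Atoms are forced at `p` when they can be added to the
succedent of `p` with a positive derivation, and the other clauses are chosen so that forcing is
monotone (`Forces.mono`) and closed under double negation (`Forces.stable`). The model therefore
obeys classical logic.

The key fact is `forces_iff_posDerivable`: for every positive formula, not only for atoms, forcing
at `p` is positive derivability relative to `p`. Since the axioms and the principal formulas of both
induction rules are positive, this lets these rules be checked in the model by applying the same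
rules inside the positive calculus, with the arbitrary side formulas replaced by the positive
formulas of the world (`Valid.posDerivable`, `Rule.valid`). Hence every derivable sequent is valid.
A positive sequent is itself a world that forces its antecedent and refutes its succedent, so
validity makes it positively derivable (`Valid.posDerivable_self`). -/

namespace APH

/-! ### Substitution calculus -/

/-- Composition of substitutions: first `σ`, then `ρ`. -/
def comp (σ ρ : ℕ → Term) : ℕ → Term := fun n => (σ n).subst ρ

/-- The substitution that maps `0` to `t` and `n + 1` to `σ n`. -/
def scons (t : Term) (σ : ℕ → Term) : ℕ → Term
  | 0 => t
  | n + 1 => σ n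

/-- The renaming `n ↦ n + 1`. -/
def wk : ℕ → Term := fun n => Term.var (n + 1)

theorem Term.subst_subst (σ ρ : ℕ → Term) (t : Term) :
    (t.subst σ).subst ρ = t.subst (comp σ ρ) := by
  induction t with
  | var n => rfl
  | cst a => rfl
  | app r t hr ht => simp only [Term.subst, hr, ht]

theorem Term.subst_var (t : Term) : t.subst Term.var = t := by
  induction t with
  | var n => rfl
  | cst a => rfl
  | app r t hr ht => simp only [Term.subst, hr, ht]

theorem Term.Closed.subst_eq {t : Term} (h : t.Closed) (σ : ℕ → Term) : t.subst σ = t := by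
  induction t with
  | var n => exact h.elim
  | cst a => rfl
  | app r t hr ht => simp only [Term.subst, hr h.1, ht h.2]

theorem Term.shift_eq (t : Term) : t.shift = t.subst wk := rfl

theorem comp_assoc (σ ρ τ : ℕ → Term) : comp (comp σ ρ) τ = comp σ (comp ρ τ) :=
  funext fun n => Term.subst_subst ρ τ (σ n)

theorem comp_var (σ : ℕ → Term) : comp σ Term.var = σ := funext fun n => Term.subst_var (σ n)

theorem var_comp (σ : ℕ → Term) : comp Term.var σ = σ := rfl

theorem wk_comp_scons (t : Term) (σ : ℕ → Term) : comp wk (scons t σ) = σ := rfl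

theorem scons_comp (t : Term) (σ ρ : ℕ → Term) :
    comp (scons t σ) ρ = scons (t.subst ρ) (comp σ ρ) := by
  funext n; cases n <;> rfl

theorem up_eq (σ : ℕ → Term) : up σ = scons (Term.var 0) (comp σ wk) := by
  funext n; cases n <;> rfl

theorem up_var : up Term.var = Term.var := by
  funext n; cases n <;> rfl

theorem up_comp_scons (σ : ℕ → Term) (t : Term) (ρ : ℕ → Term) :
    comp (up σ) (scons t ρ) = scons t (comp σ ρ) := by
  rw [up_eq, scons_comp, comp_assoc, wk_comp_scons]; rfl

theorem wk_comp_up (σ : ℕ → Term) : comp wk (up σ) = comp σ wk := by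
  rw [up_eq, wk_comp_scons]

theorem up_comp_up (σ ρ : ℕ → Term) : comp (up σ) (up ρ) = up (comp σ ρ) := by
  rw [up_eq ρ, up_comp_scons, up_eq (comp σ ρ), comp_assoc]

namespace Formula

theorem subst_subst (A : Formula) (σ ρ : ℕ → Term) :
    (A.subst σ).subst ρ = A.subst (comp σ ρ) := by
  induction A generalizing σ ρ with
  | W t => simp only [subst, Term.subst_subst]
  | eq r t => simp only [subst, Term.subst_subst]
  | neg A hA => simp only [subst, hA]
  | and A B hA hB => simp only [subst, hA, hB]
  | or A B hA hB => simp only [subst, hA, hB]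
  | imp A B hA hB => simp only [subst, hA, hB]
  | all A hA => simp only [subst, hA, up_comp_up]
  | ex A hA => simp only [subst, hA, up_comp_up]

theorem subst_var (A : Formula) : A.subst Term.var = A := by
  induction A with
  | W t => simp only [subst, Term.subst_var]
  | eq r t => simp only [subst, Term.subst_var]
  | neg A hA => simp only [subst, hA]
  | and A B hA hB => simp only [subst, hA, hB]
  | or A B hA hB => simp only [subst, hA, hB]
  | imp A B hA hB => simp only [subst, hA, hB]
  | all A hA => simp only [subst, hA, up_var]
  | ex A hA => simp only [subst, hA, up_var]

theorem shift_eq (A : Formula) : A.shift = A.subst wk := rfl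

theorem inst_eq (A : Formula) (t : Term) : A.inst t = A.subst (scons t Term.var) := by
  rw [inst]
  exact congrArg (A.subst ·) (funext fun n => by cases n <;> rfl)

theorem shift_subst_up (A : Formula) (σ : ℕ → Term) :
    A.shift.subst (up σ) = (A.subst σ).shift := by
  rw [shift_eq, shift_eq, subst_subst, subst_subst, wk_comp_up]

theorem inst_subst (A : Formula) (t : Term) (σ : ℕ → Term) :
    (A.inst t).subst σ = (A.subst (up σ)).inst (t.subst σ) := by
  rw [inst_eq, inst_eq, subst_subst, subst_subst, scons_comp, up_comp_scons, comp_var, var_comp]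

theorem subst_up_inst (A : Formula) (t : Term) (σ : ℕ → Term) :
    (A.subst (up σ)).inst t = A.subst (scons t σ) := by
  rw [inst_eq, subst_subst, up_comp_scons, comp_var]

theorem positive_subst {A : Formula} {σ : ℕ → Term} : (A.subst σ).Positive ↔ A.Positive := by
  induction A generalizing σ <;> simp_all only [subst, Positive]

theorem wFree_subst {A : Formula} {σ : ℕ → Term} : (A.subst σ).WFree ↔ A.WFree := by
  induction A generalizing σ <;> simp_all only [subst, WFree]

theorem disjFree_subst {A : Formula} {σ : ℕ → Term} : (A.subst σ).DisjFree ↔ A.DisjFree := by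
  induction A generalizing σ <;> simp_all only [subst, DisjFree]

/-- Induction formulas keep their shape under substitution, because `t` enters shifted past both
bound variables. Instances of the induction rules thus remain instances. -/
theorem bounded_subst (t : Term) (ψ : Formula) (σ : ℕ → Term) :
    (bounded t ψ).subst (up (up σ)) = bounded (t.subst σ) (ψ.subst (up (up σ))) := by
  have h : (t.shift.shift).subst (up (up σ)) = (t.subst σ).shift.shift := by
    simp only [Term.shift_eq, Term.subst_subst, wk_comp_up, comp_assoc]
    rw [← comp_assoc wk (up σ), wk_comp_up, comp_assoc]
  simp only [bounded, le, sub, csub, mult, one, zero, S1, S0, eps, subst, Term.subst, h]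
  rfl

theorem boundedEx_subst (t : Term) (ψ : Formula) (σ : ℕ → Term) :
    (boundedEx t ψ).subst (up σ) = boundedEx (t.subst σ) (ψ.subst (up (up σ))) := by
  simp only [boundedEx, subst, bounded_subst]
  rfl

/-- The formula `φ(s)`, for `s` a term that may contain the variable `0` of `φ`. -/
theorem subst_head_subst_up (A : Formula) {s s' : Term} {σ : ℕ → Term}
    (hs : s.subst (up σ) = s') :
    (A.subst (scons s wk)).subst (up σ) = (A.subst (up σ)).subst (scons s' wk) := by
  rw [subst_subst, subst_subst, scons_comp, wk_comp_up, up_comp_scons, hs]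

/-- Brings the substitutions written out in `Rule.notationInd` into the form that the substitution
calculus handles. -/
theorem match_eq_scons (s : Term) :
    (fun n => match n with
      | 0 => s
      | n + 1 => Term.var (n + 1)) = scons s wk := by
  funext n; cases n <;> rfl

/-- Closedness of `c` matters here: a substitution must not change the relation `⪰`. Later uses of
`hc` go back to this point. -/
theorem monotoneStep_subst {c : Term} (hc : c.Closed) (t : Term) (ψ : Formula) (σ : ℕ → Term) :
    (monotoneStep c t ψ).subst (up (up σ)) =
      monotoneStep c (t.subst σ) (ψ.subst (up (up σ))) := by
  simp only [monotoneStep, subst, geq, Term.subst, hc.subst_eq, subst_subst, ← bounded_subst]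
  congr 3
  congr 1
  funext n
  match n with
  | 0 => rfl
  | 1 => rfl
  | n + 2 =>
    simp only [comp, up, Term.subst, Term.shift_eq, Term.subst_subst]
    rfl

theorem positive_bounded {t : Term} {ψ : Formula} : (bounded t ψ).Positive ↔ ψ.Positive := by
  simp [bounded, Positive, le, sub]

theorem positive_boundedEx {t : Term} {ψ : Formula} : (boundedEx t ψ).Positive ↔ ψ.Positive := by
  simp [boundedEx, Positive, positive_bounded]

theorem positive_monotoneStep {c t : Term} {ψ : Formula} :
    (monotoneStep c t ψ).Positive ↔ ψ.Positive := by
  simp [monotoneStep, Positive, geq, positive_subst, positive_bounded]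

end Formula

/-! ### Substitution in sequents, axioms and rule instances. -/

open Formula

/-- Substitution in all formulas of a sequence. -/
def substAll (σ : ℕ → Term) (Γ : List Formula) : List Formula := Γ.map (Formula.subst σ)

theorem substAll_cons (σ : ℕ → Term) (A : Formula) (Γ : List Formula) :
    substAll σ (A :: Γ) = A.subst σ :: substAll σ Γ := rfl

theorem substAll_append (σ : ℕ → Term) (Γ Δ : List Formula) :
    substAll σ (Γ ++ Δ) = substAll σ Γ ++ substAll σ Δ := List.map_append

theorem substAll_shiftAll (σ : ℕ → Term) (Γ : List Formula) :
    substAll (up σ) (shiftAll Γ) = shiftAll (substAll σ Γ) := by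
  simp only [substAll, shiftAll, List.map_map]
  exact List.map_congr_left fun A _ => A.shift_subst_up σ

theorem positive_substAll {σ : ℕ → Term} {Γ : List Formula} (h : ∀ A ∈ Γ, A.Positive) :
    ∀ A ∈ substAll σ Γ, A.Positive := by
  simpa [substAll, positive_subst] using h

/-- Substitution in all formulas of a sequent. -/
def Sequent.subst (σ : ℕ → Term) (S : Sequent) : Sequent := substAll σ S.ant ⟹ substAll σ S.suc

theorem Sequent.Positive.subst {S : Sequent} (h : S.Positive) (σ : ℕ → Term) :
    (S.subst σ).Positive :=
  ⟨positive_substAll h.1, positive_substAll h.2⟩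

theorem Ax.subst {Γ Δ : List Formula} (h : Ax Γ Δ) (σ : ℕ → Term) :
    Ax (substAll σ Γ) (substAll σ Δ) := by
  cases h <;> constructor

theorem Ax.positive {Γ Δ : List Formula} (h : Ax Γ Δ) : (Γ ⟹ Δ).Positive := by
  cases h <;> simp [Sequent.Positive, Formula.Positive, sub]

theorem shift_app_subst_up (t : Term) (σ : ℕ → Term) :
    (t.shift ⬝ Term.var 0).subst (up σ) = (t.subst σ).shift ⬝ Term.var 0 := by
  simp only [Term.subst, Term.shift_eq, Term.subst_subst, wk_comp_up]
  rfl

/-- Instances of rules are closed under substitution. -/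
theorem Rule.subst {c : Term} (hc : c.Closed) {ps : List Sequent} {S : Sequent} (h : Rule c ps S)
    (σ : ℕ → Term) :
    ∃ ps', Rule c ps' (S.subst σ) ∧ List.Forall₂ (fun p p' => ∃ τ, p.subst τ = p') ps ps' := by
  cases h with
  | identity Γ Δ A => exact ⟨_, .identity _ _ _, .nil⟩
  | struct hΓ hΔ =>
    exact ⟨_, .struct (List.map_subset _ hΓ) (List.map_subset _ hΔ), .cons ⟨σ, rfl⟩ .nil⟩
  | cut Γ Δ A => exact ⟨_, .cut _ _ (A.subst σ), .cons ⟨σ, rfl⟩ (.cons ⟨σ, rfl⟩ .nil)⟩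
  | negL Γ Δ A => exact ⟨_, .negL _ _ (A.subst σ), .cons ⟨σ, rfl⟩ .nil⟩
  | negR Γ Δ A => exact ⟨_, .negR _ _ (A.subst σ), .cons ⟨σ, rfl⟩ .nil⟩
  | andL Γ Δ A B => exact ⟨_, .andL _ _ (A.subst σ) (B.subst σ), .cons ⟨σ, rfl⟩ .nil⟩
  | andR Γ Δ A B =>
    exact ⟨_, .andR _ _ (A.subst σ) (B.subst σ), .cons ⟨σ, rfl⟩ (.cons ⟨σ, rfl⟩ .nil)⟩
  | orL Γ Δ A B =>
    exact ⟨_, .orL _ _ (A.subst σ) (B.subst σ), .cons ⟨σ, rfl⟩ (.cons ⟨σ, rfl⟩ .nil)⟩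
  | orR Γ Δ A B => exact ⟨_, .orR _ _ (A.subst σ) (B.subst σ), .cons ⟨σ, rfl⟩ .nil⟩
  | impL Γ Δ A B =>
    exact ⟨_, .impL _ _ (A.subst σ) (B.subst σ), .cons ⟨σ, rfl⟩ (.cons ⟨σ, rfl⟩ .nil)⟩
  | impR Γ Δ A B => exact ⟨_, .impR _ _ (A.subst σ) (B.subst σ), .cons ⟨σ, rfl⟩ .nil⟩
  | allL Γ Δ A t =>
    exact ⟨_, .allL _ _ (A.subst (up σ)) (t.subst σ),
      .cons ⟨σ, by simp only [Sequent.subst, substAll_cons, inst_subst]; rfl⟩ .nil⟩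
  | allR Γ Δ A =>
    exact ⟨_, .allR _ _ (A.subst (up σ)),
      .cons ⟨up σ, by simp only [Sequent.subst, substAll_cons, substAll_shiftAll]; rfl⟩ .nil⟩
  | exL Γ Δ A =>
    exact ⟨_, .exL _ _ (A.subst (up σ)),
      .cons ⟨up σ, by simp only [Sequent.subst, substAll_cons, substAll_shiftAll]; rfl⟩ .nil⟩
  | exR Γ Δ A t =>
    exact ⟨_, .exR _ _ (A.subst (up σ)) (t.subst σ),
      .cons ⟨σ, by simp only [Sequent.subst, substAll_cons, inst_subst]; rfl⟩ .nil⟩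
  | ax Γ Δ h =>
    refine ⟨[], ?_, .nil⟩
    simpa only [Sequent.subst, substAll_append] using Rule.ax _ _ (h.subst σ)
  | notationInd Γ Δ t r ψ hpos hW =>
    have h := Rule.notationInd (c := c) (substAll σ Γ) (substAll σ Δ) (t.subst σ) (r.subst σ)
      (ψ.subst (up (up σ))) (positive_subst.2 hpos) (wFree_subst.2 hW)
    rw [← boundedEx_subst, match_eq_scons, match_eq_scons] at h
    rw [match_eq_scons, match_eq_scons]
    refine ⟨_, by rw [Sequent.subst, substAll_cons, substAll_cons, inst_subst]; exact h, ?_⟩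
    -- Premises with an eigenvariable are instantiated by `up σ`, which fixes the variable `0`; the
    -- base case has none and takes `σ` itself.
    refine .cons ⟨up σ, ?_⟩ (.cons ⟨σ, ?_⟩ (.cons ⟨up σ, ?_⟩ (.cons ⟨up σ, ?_⟩ .nil)))
    · simp only [Sequent.subst, substAll_cons, substAll_shiftAll, Formula.subst,
        shift_app_subst_up]
      rfl
    · simp only [Sequent.subst, substAll_cons, inst_subst]
      rfl
    all_goals
      simp only [Sequent.subst, substAll_cons, substAll_shiftAll]
      rw [subst_head_subst_up _ rfl]
      rfl
  | monotoneInd Γ Δ t r ψ hpos hW hdisj =>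
    have h := Rule.monotoneInd (c := c) (substAll σ Γ) (substAll σ Δ) (t.subst σ) (r.subst σ)
      (ψ.subst (up (up σ))) (positive_subst.2 hpos) (wFree_subst.2 hW) (disjFree_subst.2 hdisj)
    rw [← boundedEx_subst, ← bounded_subst, ← monotoneStep_subst hc] at h
    refine ⟨_, by rw [Sequent.subst, substAll_cons, substAll_cons, inst_subst]; exact h, ?_⟩
    refine .cons ⟨up σ, ?_⟩ (.cons ⟨σ, ?_⟩ (.cons ⟨up (up σ), ?_⟩ .nil))
    · simp only [Sequent.subst, substAll_cons, substAll_shiftAll, Formula.subst,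
        shift_app_subst_up]
      rfl
    · simp only [Sequent.subst, substAll_cons, inst_subst]
      rfl
    · simp only [Sequent.subst, substAll_cons, substAll_shiftAll]
      rfl

/-! ### Positive derivability -/

/-- The sequent has a derivation that consists of positive sequents. -/
inductive PosDerivable (c : Term) : Sequent → Prop
  | infer {ps : List Sequent} {S : Sequent} (h : Rule c ps S) (hS : S.Positive)
      (hps : ∀ p ∈ ps, PosDerivable c p) : PosDerivable c S

theorem PosDerivable.exists_derivation {c : Term} {S : Sequent} (h : PosDerivable c S) :
    ∃ d : Derivation c S, ∀ A, d.Contains A → A.Positive := by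
  induction h with
  | infer h hS _ ih =>
    choose ds hds using ih
    refine ⟨.infer h ds, fun A hA => ?_⟩
    rw [Derivation.Contains] at hA
    rcases hA with hA | hA | ⟨p, hp, hA⟩
    · exact hS.1 A hA
    · exact hS.2 A hA
    · exact hds p hp A hA

/-- The induction must run over all `σ` at once, as `Rule.subst` gives each premise a substitution
of its own. This closure property is what makes forcing of atoms monotone. -/
theorem PosDerivable.subst {c : Term} (hc : c.Closed) {S : Sequent} (h : PosDerivable c S)
    (σ : ℕ → Term) : PosDerivable c (S.subst σ) := by
  induction h generalizing σ with
  | infer h hS _ ih =>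
    obtain ⟨ps', h', hps⟩ := h.subst hc σ
    refine .infer h' (hS.subst σ) fun p' hp' => ?_
    clear h h' hS
    induction hps with
    | nil => simp at hp'
    | cons hp _ ih' =>
      rcases List.mem_cons.1 hp' with rfl | hp'
      · obtain ⟨τ, rfl⟩ := hp
        exact ih _ (by simp) τ
      · exact ih' (fun p hp => by grind) (fun p hp => ih p (by simp [hp])) hp'

theorem PosDerivable.positive {c : Term} {S : Sequent} (h : PosDerivable c S) : S.Positive := by
  cases h; assumption

theorem Sequent.positive_cons_ant {A : Formula} {Γ Δ : List Formula} :
    (A :: Γ ⟹ Δ).Positive ↔ A.Positive ∧ (Γ ⟹ Δ).Positive := by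
  simp [Sequent.Positive, and_assoc]

theorem Sequent.positive_cons_suc {A : Formula} {Γ Δ : List Formula} :
    (Γ ⟹ A :: Δ).Positive ↔ A.Positive ∧ (Γ ⟹ Δ).Positive := by
  simp [Sequent.Positive]; tauto

namespace PosDerivable

variable {c : Term} {Γ Γ' Δ Δ' : List Formula} {A : Formula}

theorem weaken (h : PosDerivable c (Γ ⟹ Δ)) (hS : (Γ' ⟹ Δ').Positive) (hΓ : Γ ⊆ Γ')
    (hΔ : Δ ⊆ Δ') : PosDerivable c (Γ' ⟹ Δ') :=
  .infer (.struct hΓ hΔ) hS (by simpa using h)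

theorem one {S : Sequent} {p : Sequent} (hS : S.Positive) (h : Rule c [p] S)
    (hp : PosDerivable c p) : PosDerivable c S :=
  .infer h hS (by simpa using hp)

theorem two {S : Sequent} {p q : Sequent} (hS : S.Positive) (h : Rule c [p, q] S)
    (hp : PosDerivable c p) (hq : PosDerivable c q) : PosDerivable c S :=
  .infer h hS (by simpa using ⟨hp, hq⟩)

theorem cut (h : PosDerivable c (Γ ⟹ A :: Δ)) (h' : PosDerivable c (A :: Γ ⟹ Δ)) :
    PosDerivable c (Γ ⟹ Δ) :=
  two (Sequent.positive_cons_suc.1 h.positive).2 (.cut _ _ A) h h'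

theorem of_mem (hS : (Γ ⟹ Δ).Positive) (h : A ∈ Γ) (h' : A ∈ Δ) : PosDerivable c (Γ ⟹ Δ) :=
  weaken (.infer (.identity [] [] A) (by simpa [Sequent.Positive] using hS.1 A h) (by simp)) hS
    (by simpa using h) (by simpa using h')

end PosDerivable

/-! ### The Boolean-valued model -/

/-- The sequent `q` extends the instance of the sequent `p` under `ρ`, and is positive. -/
structure Ext (ρ : ℕ → Term) (p q : Sequent) : Prop where
  pos : q.Positive
  ant : substAll ρ p.ant ⊆ q.ant
  suc : substAll ρ p.suc ⊆ q.suc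

theorem substAll_var (Γ : List Formula) : substAll Term.var Γ = Γ := by
  have : Formula.subst Term.var = id := funext fun A => A.subst_var
  simp [substAll, this]

theorem substAll_substAll (σ ρ : ℕ → Term) (Γ : List Formula) :
    substAll ρ (substAll σ Γ) = substAll (comp σ ρ) Γ := by
  simp only [substAll, List.map_map]
  exact List.map_congr_left fun A _ => A.subst_subst σ ρ

theorem Ext.of_subset {p q : Sequent} (hq : q.Positive) (h : p.ant ⊆ q.ant) (h' : p.suc ⊆ q.suc) :
    Ext Term.var p q :=
  ⟨hq, by rwa [substAll_var], by rwa [substAll_var]⟩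

theorem Ext.refl {p : Sequent} (hp : p.Positive) : Ext Term.var p p :=
  .of_subset hp (fun _ h => h) (fun _ h => h)

theorem Ext.trans {ρ τ : ℕ → Term} {p q r : Sequent} (h : Ext ρ p q) (h' : Ext τ q r) :
    Ext (comp ρ τ) p r :=
  ⟨h'.pos, by rw [← substAll_substAll]; exact List.Subset.trans (List.map_subset _ h.ant) h'.ant,
    by rw [← substAll_substAll]; exact List.Subset.trans (List.map_subset _ h.suc) h'.suc⟩

/-- No consistent extension of `p` satisfies `F`, where a positive sequent counts as
inconsistent if it is positively derivable. -/
def Refutes (c : Term) (F : (ℕ → Term) → Sequent → Prop) (σ : ℕ → Term) (p : Sequent) : Prop :=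
  ∀ ρ q, Ext ρ p q → F (comp σ ρ) q → PosDerivable c q

/-- The sequent `p` forces the formula `A` under the assignment `σ`. -/
def Forces (c : Term) : Formula → (ℕ → Term) → Sequent → Prop
  -- The succedent of `p` stays as a list of alternatives, so an inconsistent world forces every
  -- atom.
  | .W t => fun σ p => PosDerivable c (p.ant ⟹ .W (t.subst σ) :: p.suc)
  | .eq r t => fun σ p => PosDerivable c (p.ant ⟹ .eq (r.subst σ) (t.subst σ) :: p.suc)
  | .neg A => fun σ p => Refutes c (Forces c A) σ p
  | .and A B => fun σ p => Forces c A σ p ∧ Forces c B σ p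
  -- Disjunction is read as `¬(¬A ∧ ¬B)`, and `∃` below as `¬∀¬`; this builds in closure under
  -- double negation.
  | .or A B => fun σ p => ∀ ρ q, Ext ρ p q → Refutes c (Forces c A) (comp σ ρ) q →
      Refutes c (Forces c B) (comp σ ρ) q → PosDerivable c q
  | .imp A B => fun σ p => ∀ ρ q, Ext ρ p q → Forces c A (comp σ ρ) q → Forces c B (comp σ ρ) q
  | .all A => fun σ p => ∀ ρ q t, Ext ρ p q → Forces c A (scons t (comp σ ρ)) q
  | .ex A => fun σ p => ∀ ρ q, Ext ρ p q →
      (∀ τ r t, Ext τ q r → Forces c A (scons t (comp (comp σ ρ) τ)) r → PosDerivable c r) →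
      PosDerivable c q

theorem Refutes.mono {c : Term} {F : (ℕ → Term) → Sequent → Prop} {σ ρ : ℕ → Term}
    {p q : Sequent} (h : Refutes c F σ p) (hpq : Ext ρ p q) : Refutes c F (comp σ ρ) q :=
  fun τ r hr hF => h (comp ρ τ) r (hpq.trans hr) (by rwa [← comp_assoc])

theorem PosDerivable.ext {c : Term} (hc : c.Closed) {B : Formula} {ρ : ℕ → Term} {p q : Sequent}
    (hB : PosDerivable c (p.ant ⟹ B :: p.suc)) (hpq : Ext ρ p q) :
    PosDerivable c (q.ant ⟹ B.subst ρ :: q.suc) :=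
  (hB.subst hc ρ).weaken
    (Sequent.positive_cons_suc.2
      ⟨positive_subst.2 (Sequent.positive_cons_suc.1 hB.positive).1, hpq.pos⟩)
    hpq.ant (List.cons_subset_cons _ hpq.suc)

theorem Forces.mono {c : Term} (hc : c.Closed) {A : Formula} {σ ρ : ℕ → Term} {p q : Sequent}
    (h : Forces c A σ p) (hpq : Ext ρ p q) : Forces c A (comp σ ρ) q := by
  induction A generalizing σ with
  | W t =>
    have := PosDerivable.ext hc h hpq
    rwa [Formula.subst, Term.subst_subst] at this
  | eq r t =>
    have := PosDerivable.ext hc h hpq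
    rwa [Formula.subst, Term.subst_subst, Term.subst_subst] at this
  | neg A => exact Refutes.mono h hpq
  | and A B hA hB => exact ⟨hA h.1, hB h.2⟩
  | or A B =>
    intro τ r hr
    rw [comp_assoc]
    exact h _ r (hpq.trans hr)
  | imp A B =>
    intro τ r hr
    rw [comp_assoc]
    exact h _ r (hpq.trans hr)
  | all A =>
    intro τ r t hr
    rw [comp_assoc]
    exact h _ r t (hpq.trans hr)
  | ex A =>
    intro τ r hr
    rw [comp_assoc σ]
    exact h _ r (hpq.trans hr)

theorem Refutes.apply {c : Term} {F : (ℕ → Term) → Sequent → Prop} {σ : ℕ → Term}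
    {p : Sequent} (hp : p.Positive) (h : Refutes c F σ p) (hF : F σ p) : PosDerivable c p :=
  h Term.var p (.refl hp) (by rwa [comp_var])

theorem PosDerivable.contract {c : Term} {Γ Δ : List Formula} {B : Formula}
    (h : PosDerivable c (Γ ⟹ B :: Δ)) (hB : B ∈ Δ) : PosDerivable c (Γ ⟹ Δ) :=
  h.weaken (Sequent.positive_cons_suc.1 h.positive).2 (fun _ h => h)
    (List.cons_subset.2 ⟨hB, fun _ h => h⟩)

theorem Ext.mem_suc {ρ : ℕ → Term} {B : Formula} {Γ Δ : List Formula} {q : Sequent}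
    (h : Ext ρ (Γ ⟹ B :: Δ) q) : B.subst ρ ∈ q.suc :=
  h.suc (by simp [substAll])

/-- The atomic case of stability. The hypothesis is used at the world `p` with `B` added to its
succedent: this world refutes `F`, since below it a derivation with one more copy of `B` contracts
to a derivation of the world. -/
theorem posDerivable_of_stable {c : Term} {F : (ℕ → Term) → Sequent → Prop} {B : Formula}
    {σ : ℕ → Term} {p : Sequent} (hp : p.Positive) (hB : B.Positive)
    (hF : ∀ ρ q, F (comp σ ρ) q → PosDerivable c (q.ant ⟹ B.subst ρ :: q.suc))
    (h : ∀ ρ q, Ext ρ p q → Refutes c F (comp σ ρ) q → PosDerivable c q) :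
    PosDerivable c (p.ant ⟹ B :: p.suc) := by
  refine h Term.var _
    (.of_subset (Sequent.positive_cons_suc.2 ⟨hB, hp⟩) (by simp) (by simp)) fun ρ q hpq hA => ?_
  rw [comp_var] at hA
  exact (hF ρ q hA).contract hpq.mem_suc

/-- A sequent forces all formulas that no extension refutes consistently. -/
theorem Forces.stable {c : Term} (hc : c.Closed) {A : Formula} {σ : ℕ → Term} {p : Sequent}
    (hp : p.Positive)
    (h : ∀ ρ q, Ext ρ p q → Refutes c (Forces c A) (comp σ ρ) q → PosDerivable c q) :
    Forces c A σ p := by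
  induction A generalizing σ p with
  | W t =>
    refine posDerivable_of_stable hp trivial (fun ρ q h => ?_) h
    rw [Formula.subst, Term.subst_subst]
    exact h
  | eq r t =>
    refine posDerivable_of_stable hp trivial (fun ρ q h => ?_) h
    rw [Formula.subst, Term.subst_subst, Term.subst_subst]
    exact h
  | neg A =>
    intro ρ q hpq hA
    refine h ρ q hpq fun τ r hqr hr => ?_
    exact Refutes.apply hqr.pos hr (hA.mono hc hqr)
  | and A B hA hB =>
    exact ⟨hA hp fun ρ q hpq hq => h ρ q hpq fun τ r hqr hr => hq τ r hqr hr.1,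
      hB hp fun ρ q hpq hq => h ρ q hpq fun τ r hqr hr => hq τ r hqr hr.2⟩
  | or A B =>
    intro ρ q hpq hA hB
    refine h ρ q hpq fun τ r hqr hr => ?_
    refine hr Term.var r (.refl hqr.pos) ?_ ?_
    · rw [comp_var]; exact hA.mono hqr
    · rw [comp_var]; exact hB.mono hqr
  | imp A B _ hB =>
    intro ρ q hpq hA
    -- The clause for implication has no double negation of its own and inherits stability from `B`:
    -- where `B` is refuted and `A` is forced, the implication is refuted as well.
    refine hB hpq.pos fun τ r hqr hr => ?_
    rw [comp_assoc] at hr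
    refine h _ r (hpq.trans hqr) fun υ s hrs hs => hr υ s hrs ?_
    have := hs Term.var s (.refl hrs.pos)
    rw [comp_var] at this
    refine this ?_
    rw [← comp_assoc]
    exact (hA.mono hc hqr).mono hc hrs
  | all A hA =>
    intro ρ q t hpq
    refine hA hpq.pos fun τ r hqr hr => ?_
    rw [scons_comp, comp_assoc] at hr
    refine h _ r (hpq.trans hqr) fun υ s hrs hs => hr υ s hrs ?_
    have := hs Term.var s ((t.subst τ).subst υ) (.refl hrs.pos)
    rwa [comp_var, ← scons_comp] at this
  | ex A =>
    intro ρ q hpq hA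
    refine h ρ q hpq fun τ r hqr hr => ?_
    refine hr Term.var r (.refl hqr.pos) fun υ s t hrs hs => ?_
    rw [comp_var, comp_assoc] at hs
    exact hA (comp τ υ) s t (hqr.trans hrs) hs

/-! ### Positive cuts, and the agreement of forcing with positive derivability. -/

namespace PosDerivable

variable {c : Term} {Γ Γ₀ Δ Δ₀ : List Formula} {A B : Formula}

theorem mp (h : PosDerivable c (Γ ⟹ A :: Δ)) (h' : PosDerivable c (A :: Γ ⟹ B :: Δ)) :
    PosDerivable c (Γ ⟹ B :: Δ) := by
  refine cut (h.weaken ?_ (fun _ h => h) (List.cons_subset_cons _ (by simp))) h'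
  have h₁ := Sequent.positive_cons_suc.1 h.positive
  exact Sequent.positive_cons_suc.2 ⟨h₁.1, (Sequent.positive_cons_ant.1 h'.positive).2⟩

theorem cut_ant (h₀ : ∀ A ∈ Γ₀, PosDerivable c (Γ ⟹ A :: Δ))
    (h : PosDerivable c (Γ₀ ++ Γ ⟹ Δ)) : PosDerivable c (Γ ⟹ Δ) := by
  induction Γ₀ with
  | nil => exact h
  | cons B Γ₀ ih =>
    refine ih (fun A hA => h₀ A (by simp [hA])) (cut ((h₀ B (by simp)).weaken ?_ ?_ ?_) h)
    · have h₁ := Sequent.positive_cons_ant.1 h.positive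
      exact Sequent.positive_cons_suc.2 h₁
    · simp
    · exact fun _ h => h

theorem cut_suc (h₀ : ∀ A ∈ Δ₀, PosDerivable c (A :: Γ ⟹ Δ))
    (h : PosDerivable c (Γ ⟹ Δ₀ ++ Δ)) : PosDerivable c (Γ ⟹ Δ) := by
  induction Δ₀ with
  | nil => exact h
  | cons B Δ₀ ih =>
    refine ih (fun A hA => h₀ A (by simp [hA])) (cut h ((h₀ B (by simp)).weaken ?_ ?_ ?_))
    · have h₁ := Sequent.positive_cons_suc.1 h.positive
      exact Sequent.positive_cons_ant.2 h₁
    · exact fun _ h => h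
    · simp

end PosDerivable

/-- Adding `A` to the antecedent gives an extension that derives `A` by identity. If it thereby
forces `A`, refutation makes it derivable. The hypothesis `hF` is half of `forces_iff_posDerivable`,
kept separate so that this can be used within the induction proving that equivalence. -/
theorem Refutes.posDerivable_of_forces {c : Term} {A : Formula} (hA : A.Positive) {σ : ℕ → Term}
    {p : Sequent} (hp : p.Positive) (h : Refutes c (Forces c A) σ p)
    (hF : ∀ q : Sequent, PosDerivable c (q.ant ⟹ A.subst σ :: q.suc) → Forces c A σ q) :
    PosDerivable c (A.subst σ :: p.ant ⟹ p.suc) := by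
  have hpos := Sequent.positive_cons_ant.2 ⟨(positive_subst (σ := σ)).2 hA, hp⟩
  refine h Term.var _ (.of_subset hpos (by simp) (by simp)) ?_
  rw [comp_var]
  exact hF _ (.of_mem (A := A.subst σ)
    (Sequent.positive_cons_suc.2 ⟨positive_subst.2 hA, hpos⟩) (by simp) (by simp))

theorem Ext.wk {p : Sequent} (hp : p.Positive) : Ext wk p (p.subst wk) :=
  ⟨hp.subst _, fun _ h => h, fun _ h => h⟩

/-- For positive formulas, forcing is positive derivability. -/
theorem forces_iff_posDerivable {c : Term} (hc : c.Closed) {A : Formula} (hA : A.Positive)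
    {σ : ℕ → Term} {p : Sequent} (hp : p.Positive) :
    Forces c A σ p ↔ PosDerivable c (p.ant ⟹ A.subst σ :: p.suc) := by
  have hcl {B : Formula} (hB : B.Positive) {τ : ℕ → Term} {q : Sequent} (hq : q.Positive) :
      (q.ant ⟹ B.subst τ :: q.suc).Positive :=
    Sequent.positive_cons_suc.2 ⟨positive_subst.2 hB, hq⟩
  have hal {B : Formula} (hB : B.Positive) {τ : ℕ → Term} {q : Sequent} (hq : q.Positive) :
      (B.subst τ :: q.ant ⟹ q.suc).Positive :=
    Sequent.positive_cons_ant.2 ⟨positive_subst.2 hB, hq⟩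
  induction A generalizing σ p with
  | W t => exact Iff.rfl
  | eq r t => exact Iff.rfl
  | neg A => exact hA.elim
  | imp A B => exact hA.elim
  | and A B ihA ihB =>
    constructor
    · intro h
      exact .two (hcl hA hp) (.andR _ _ _ _) ((ihA hA.1 hp).1 h.1) ((ihB hA.2 hp).1 h.2)
    · intro h
      have hA' := hal (τ := σ) hA hp
      refine ⟨(ihA hA.1 hp).2 (.mp h ?_), (ihB hA.2 hp).2 (.mp h ?_)⟩
      · refine .one (hcl hA.1 hA') (.andL _ _ _ _) (.of_mem (A := A.subst σ) ?_ (by simp) (by simp))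
        exact hal hA.1 (hal hA.2 (hcl hA.1 hp))
      · refine .one (hcl hA.2 hA') (.andL _ _ _ _) (.of_mem (A := B.subst σ) ?_ (by simp) (by simp))
        exact hal hA.1 (hal hA.2 (hcl hA.2 hp))
  | or A B ihA ihB =>
    constructor
    · intro h
      -- The world tested is `p` with the disjunction itself in the succedent. Below it each
      -- disjunct is refuted, because `orR` followed by contraction into that copy derives the
      -- world.
      refine h Term.var _ (.of_subset (hcl hA hp) (by simp) (by simp)) ?_ ?_
      all_goals
        intro ρ q hpq hq
        rw [comp_var] at hq
        have hmem := hpq.mem_suc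
        rw [Formula.subst_subst] at hmem
        refine PosDerivable.contract (.one (hcl hA hpq.pos) (.orR _ _ _ _) ?_) hmem
      · exact ((ihA hA.1 hpq.pos).1 hq).weaken (hcl hA.1 (hcl hA.2 hpq.pos)) (by simp)
          (List.cons_subset_cons _ (by simp))
      · exact ((ihB hA.2 hpq.pos).1 hq).weaken (hcl hA.1 (hcl hA.2 hpq.pos)) (by simp) (by simp)
    · intro h ρ q hpq hqA hqB
      have h' := h.ext hc hpq
      rw [Formula.subst_subst] at h'
      refine h'.cut (.two (hal hA hpq.pos) (.orL _ _ _ _) ?_ ?_)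
      · exact hqA.posDerivable_of_forces hA.1 hpq.pos fun r hr =>
          (ihA hA.1 (Sequent.positive_cons_suc.1 hr.positive).2).2 hr
      · exact hqB.posDerivable_of_forces hA.2 hpq.pos fun r hr =>
          (ihB hA.2 (Sequent.positive_cons_suc.1 hr.positive).2).2 hr
  | all A ih =>
    constructor
    · intro h
      -- The generic instance: in the renamed world the variable `0` is fresh, which gives the
      -- premise of `allR`.
      have h' := h wk _ (Term.var 0) (.wk hp)
      rw [← up_eq] at h'
      exact .one (hcl hA hp) (.allR _ _ _) ((ih hA (hp.subst wk)).1 h')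
    · intro h ρ q t hpq
      have h' := h.ext hc hpq
      rw [Formula.subst_subst] at h'
      refine (ih hA hpq.pos).2 (.mp h' ?_)
      refine .one (hal (B := .all A) hA (hcl (B := A) hA hpq.pos)) (.allL _ _ _ t)
        (.of_mem (A := A.subst (scons t (comp σ ρ))) ?_ ?_ ?_)
      · rw [subst_up_inst]
        exact hal (B := A) hA (hcl (B := A) hA hpq.pos)
      · rw [subst_up_inst]
        exact List.mem_cons_self
      · exact List.mem_cons_self
  | ex A ih =>
    constructor
    · intro h
      refine h Term.var _ (.of_subset (hcl hA hp) (by simp) (by simp)) fun ρ q t hpq hq => ?_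
      rw [comp_var] at hq
      have hmem := hpq.mem_suc
      rw [Formula.subst_subst] at hmem
      refine PosDerivable.contract (.one (hcl hA hpq.pos) (.exR _ _ _ t) ?_) hmem
      rw [subst_up_inst]
      exact (ih hA hpq.pos).1 hq
    · intro h ρ q hpq hq
      have h' := h.ext hc hpq
      rw [Formula.subst_subst] at h'
      refine h'.cut (.one (hal hA hpq.pos) (.exL _ _ _) ?_)
      have hpos := hal (B := A) (τ := up (comp σ ρ)) hA (hpq.pos.subst wk)
      -- The premise of `exL` is itself an extension of `q` along `wk`, and it forces `A` at the
      -- eigenvariable by identity.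
      refine hq wk _ (Term.var 0) ⟨hpos, List.subset_cons_self _ _, fun _ h => h⟩ ?_
      rw [← up_eq]
      exact (ih hA hpos).2 (.of_mem (hcl (B := A) hA hpos) List.mem_cons_self List.mem_cons_self)

theorem Refutes.posDerivable {c : Term} (hc : c.Closed) {A : Formula} (hA : A.Positive)
    {σ : ℕ → Term} {p : Sequent} (hp : p.Positive) (h : Refutes c (Forces c A) σ p) :
    PosDerivable c (A.subst σ :: p.ant ⟹ p.suc) :=
  h.posDerivable_of_forces hA hp fun _ hq =>
    (forces_iff_posDerivable hc hA (Sequent.positive_cons_suc.1 hq.positive).2).2 hq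

theorem forces_subst {c : Term} {A : Formula} {τ σ : ℕ → Term} {p : Sequent} :
    Forces c (A.subst τ) σ p ↔ Forces c A (comp τ σ) p := by
  induction A generalizing τ σ p with
  | W t => simp only [Formula.subst, Forces, Term.subst_subst]
  | eq r t => simp only [Formula.subst, Forces, Term.subst_subst]
  | neg A hA => simp only [Formula.subst, Forces, Refutes, hA, comp_assoc]
  | and A B hA hB => simp only [Formula.subst, Forces, hA, hB]
  | or A B hA hB => simp only [Formula.subst, Forces, Refutes, hA, hB, comp_assoc]
  | imp A B hA hB => simp only [Formula.subst, Forces, hA, hB, comp_assoc]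
  | all A hA => simp only [Formula.subst, Forces, hA, comp_assoc, up_comp_scons]
  | ex A hA => simp only [Formula.subst, Forces, hA, comp_assoc, up_comp_scons]

theorem refutes_subst {c : Term} {A : Formula} {τ σ : ℕ → Term} {p : Sequent} :
    Refutes c (Forces c (A.subst τ)) σ p ↔ Refutes c (Forces c A) (comp τ σ) p := by
  simp only [Refutes, forces_subst, comp_assoc]

/-! ### Soundness -/

/-- The sequent `p` forces all formulas of `Γ` and refutes all formulas of `Δ`. -/
structure Separates (c : Term) (S : Sequent) (σ : ℕ → Term) (p : Sequent) : Prop where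
  pos : p.Positive
  ant : ∀ A ∈ S.ant, Forces c A σ p
  suc : ∀ A ∈ S.suc, Refutes c (Forces c A) σ p

/-- The sequent `S` is valid in the model of positively underivable sequents. -/
def Valid (c : Term) (S : Sequent) : Prop := ∀ σ p, Separates c S σ p → PosDerivable c p

namespace Separates

variable {c : Term} {Γ Δ : List Formula} {σ ρ : ℕ → Term} {p q : Sequent} {A : Formula}

theorem ant_cons (h : Separates c (Γ ⟹ Δ) σ p) (hA : Forces c A σ p) :
    Separates c (A :: Γ ⟹ Δ) σ p :=
  ⟨h.pos, List.forall_mem_cons.2 ⟨hA, h.ant⟩, h.suc⟩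

theorem suc_cons (h : Separates c (Γ ⟹ Δ) σ p) (hA : Refutes c (Forces c A) σ p) :
    Separates c (Γ ⟹ A :: Δ) σ p :=
  ⟨h.pos, h.ant, List.forall_mem_cons.2 ⟨hA, h.suc⟩⟩

theorem of_ant_cons (h : Separates c (A :: Γ ⟹ Δ) σ p) :
    Forces c A σ p ∧ Separates c (Γ ⟹ Δ) σ p :=
  ⟨h.ant A (by simp), h.pos, fun B hB => h.ant B (by simp [hB]), h.suc⟩

theorem of_suc_cons (h : Separates c (Γ ⟹ A :: Δ) σ p) :
    Refutes c (Forces c A) σ p ∧ Separates c (Γ ⟹ Δ) σ p :=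
  ⟨h.suc A (by simp), h.pos, h.ant, fun B hB => h.suc B (by simp [hB])⟩

theorem mono (hc : c.Closed) (h : Separates c (Γ ⟹ Δ) σ p) (hpq : Ext ρ p q) :
    Separates c (Γ ⟹ Δ) (comp σ ρ) q :=
  ⟨hpq.pos, fun A hA => (h.ant A hA).mono hc hpq, fun A hA => (h.suc A hA).mono hpq⟩

theorem shift (h : Separates c (Γ ⟹ Δ) σ p) (t : Term) :
    Separates c (shiftAll Γ ⟹ shiftAll Δ) (scons t σ) p := by
  refine ⟨h.pos, List.forall_mem_map.2 fun A hA => ?_, List.forall_mem_map.2 fun A hA => ?_⟩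
  · exact forces_subst.2 (h.ant A hA)
  · exact refutes_subst.2 (h.suc A hA)

/-- Serves the premises with eigenvariables: in the renamed world the variable `0` is fresh and is
interpreted by itself. -/
theorem shift_wk (hc : c.Closed) (h : Separates c (Γ ⟹ Δ) σ p) :
    Separates c (shiftAll Γ ⟹ shiftAll Δ) (up σ) (p.subst wk) := by
  rw [up_eq]
  exact (h.mono hc (.wk h.pos)).shift _

end Separates

/-- A valid sequent with positive principal formulas turns into a positively derivable one when
its side formulas are replaced by a sequent that separates them. -/
theorem Valid.posDerivable {c : Term} (hc : c.Closed) {Γ₀ Γ Δ : List Formula} {D : Formula}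
    (h : Valid c (Γ₀ ++ Γ ⟹ D :: Δ)) (hΓ₀ : ∀ A ∈ Γ₀, A.Positive) (hD : D.Positive)
    {σ : ℕ → Term} {p : Sequent} (hp : Separates c (Γ ⟹ Δ) σ p) :
    PosDerivable c (substAll σ Γ₀ ++ p.ant ⟹ D.subst σ :: p.suc) := by
  have hpos : (substAll σ Γ₀ ++ p.ant ⟹ p.suc).Positive :=
    ⟨fun A hA => (List.mem_append.1 hA).elim (positive_substAll hΓ₀ A) (hp.pos.1 A), hp.pos.2⟩
  have hpos' : (substAll σ Γ₀ ++ p.ant ⟹ D.subst σ :: p.suc).Positive :=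
    Sequent.positive_cons_suc.2 ⟨positive_subst.2 hD, hpos⟩
  have hp' := hp.mono hc (Ext.of_subset hpos' (by simp) (by simp))
  rw [comp_var] at hp'
  -- Validity is applied at the very sequent to be derived: it forces `Γ₀` by identity, and refutes
  -- `D` because `D` already stands in its succedent.
  refine h σ _ (Separates.suc_cons ⟨hpos', fun A hA => ?_, hp'.suc⟩ ?_)
  · rcases List.mem_append.1 hA with hA | hA
    · refine (forces_iff_posDerivable hc (hΓ₀ A hA) hpos').2 (.of_mem (A := A.subst σ) ?_ ?_ ?_)
      · exact Sequent.positive_cons_suc.2 ⟨positive_subst.2 (hΓ₀ A hA), hpos'⟩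
      · exact List.mem_append_left _ (List.mem_map_of_mem hA)
      · exact List.mem_cons_self
    · exact hp'.ant A hA
  · intro ρ q hpq hq
    have := (forces_iff_posDerivable hc hD hpq.pos).1 hq
    rw [← Formula.subst_subst] at this
    exact this.contract hpq.mem_suc

/-- The logical rules follow from the forcing clauses, with `Forces.stable` supplying the classical
strength in `impR` and `allR`. Axioms and inductions are simulated in the positive calculus over the
formulas of the world `p`. -/
theorem Rule.valid {c : Term} (hc : c.Closed) {ps : List Sequent} {S : Sequent} (h : Rule c ps S)
    (hps : ∀ p ∈ ps, Valid c p) : Valid c S := by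
  intro σ p hp
  -- A refuted positive formula can be cut away from the succedent.
  have hcl {A : Formula} (hA : A.Positive) (hq : Refutes c (Forces c A) σ p)
      (h : PosDerivable c (p.ant ⟹ A.subst σ :: p.suc)) : PosDerivable c p :=
    h.cut (hq.posDerivable hc hA hp.pos)
  cases h with
  | identity Γ Δ A => exact hp.of_suc_cons.1.apply hp.pos hp.of_ant_cons.1
  | struct hΓ hΔ =>
    exact hps _ List.mem_cons_self σ p
      ⟨hp.pos, fun A hA => hp.ant A (hΓ hA), fun A hA => hp.suc A (hΔ hA)⟩
  | cut Γ Δ A =>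
    refine hps _ List.mem_cons_self σ p (hp.suc_cons fun ρ q hpq hq => ?_)
    exact hps (A :: Γ ⟹ Δ) (by simp) _ q ((hp.mono hc hpq).ant_cons hq)
  | negL Γ Δ A =>
    obtain ⟨hA, hp⟩ := hp.of_ant_cons
    exact hps _ List.mem_cons_self σ p (hp.suc_cons hA)
  | negR Γ Δ A =>
    obtain ⟨hA, hp⟩ := hp.of_suc_cons
    exact hA.apply hp.pos fun ρ q hpq hq =>
      hps _ List.mem_cons_self _ q ((hp.mono hc hpq).ant_cons hq)
  | andL Γ Δ A B =>
    obtain ⟨hA, hp⟩ := hp.of_ant_cons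
    exact hps _ List.mem_cons_self σ p ((hp.ant_cons hA.2).ant_cons hA.1)
  | andR Γ Δ A B =>
    obtain ⟨hA, hp⟩ := hp.of_suc_cons
    refine hps _ List.mem_cons_self σ p (hp.suc_cons fun ρ q hpq hq => ?_)
    refine hps (Γ ⟹ B :: Δ) (by simp) _ q ((hp.mono hc hpq).suc_cons fun τ r hqr hr => ?_)
    exact (hA.mono hpq).mono hqr |>.apply hqr.pos ⟨hq.mono hc hqr, hr⟩
  | orL Γ Δ A B =>
    obtain ⟨hA, hp⟩ := hp.of_ant_cons
    refine hA Term.var p (.refl hp.pos) ?_ ?_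
    all_goals
      rw [comp_var]
      intro ρ q hpq hq
    · exact hps _ List.mem_cons_self _ q ((hp.mono hc hpq).ant_cons hq)
    · exact hps (B :: Γ ⟹ Δ) (by simp) _ q ((hp.mono hc hpq).ant_cons hq)
  | orR Γ Δ A B =>
    obtain ⟨hA, hp⟩ := hp.of_suc_cons
    refine hps _ List.mem_cons_self σ p ((hp.suc_cons fun ρ q hpq hq => ?_).suc_cons
      fun ρ q hpq hq => ?_)
    · exact hA ρ q hpq fun τ r hqr _ hr => hr.apply hqr.pos (hq.mono hc hqr)
    · exact hA ρ q hpq fun τ r hqr hr _ => hr.apply hqr.pos (hq.mono hc hqr)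
  | impL Γ Δ A B =>
    obtain ⟨hA, hp⟩ := hp.of_ant_cons
    refine hps _ List.mem_cons_self σ p (hp.suc_cons fun ρ q hpq hq => ?_)
    exact hps (B :: Γ ⟹ Δ) (by simp) _ q ((hp.mono hc hpq).ant_cons (hA ρ q hpq hq))
  | impR Γ Δ A B =>
    obtain ⟨hA, hp⟩ := hp.of_suc_cons
    -- Validity of the premise only yields inconsistency of worlds that refute `B`; stability turns
    -- this into forcing of `B`.
    refine hA.apply hp.pos fun ρ q hpq hq => Forces.stable hc hpq.pos fun τ r hqr hr => ?_
    exact hps _ List.mem_cons_self _ r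
      ((((hp.mono hc hpq).mono hc hqr).suc_cons hr).ant_cons (hq.mono hc hqr))
  | allL Γ Δ A t =>
    obtain ⟨hA, hp⟩ := hp.of_ant_cons
    refine hps _ List.mem_cons_self σ p (hp.ant_cons ?_)
    have := hA Term.var p (t.subst σ) (.refl hp.pos)
    rw [inst_eq, forces_subst, scons_comp, var_comp]
    rwa [comp_var] at this
  | allR Γ Δ A =>
    obtain ⟨hA, hp⟩ := hp.of_suc_cons
    refine hA.apply hp.pos fun ρ q t hpq => Forces.stable hc hpq.pos fun τ r hqr hr => ?_
    exact hps _ List.mem_cons_self _ r ((((hp.mono hc hpq).shift t).mono hc hqr).suc_cons hr)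
  | exL Γ Δ A =>
    obtain ⟨hA, hp⟩ := hp.of_ant_cons
    refine hA Term.var p (.refl hp.pos) fun ρ q t hpq hq => ?_
    rw [comp_var] at hq
    exact hps _ List.mem_cons_self _ q (((hp.mono hc hpq).shift t).ant_cons hq)
  | exR Γ Δ A t =>
    obtain ⟨hA, hp⟩ := hp.of_suc_cons
    refine hps _ List.mem_cons_self σ p (hp.suc_cons fun ρ q hpq hq => ?_)
    refine hA ρ q hpq fun τ r hqr hr => ?_
    refine hr Term.var r ((t.subst (comp σ ρ)).subst τ) (.refl hqr.pos) ?_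
    have := hq.mono hc hqr
    rw [inst_eq, forces_subst, comp_assoc, scons_comp, var_comp] at this
    rwa [comp_var, Term.subst_subst, comp_assoc]
  | ax Γ Δ h =>
    rename_i Γ₀ Δ₀
    have hpos := h.positive
    have hd : PosDerivable c (substAll σ Γ₀ ++ p.ant ⟹ substAll σ Δ₀ ++ p.suc) :=
      .infer (.ax _ _ (h.subst σ))
        ⟨fun A hA => (List.mem_append.1 hA).elim (positive_substAll hpos.1 A) (hp.pos.1 A),
          fun A hA => (List.mem_append.1 hA).elim (positive_substAll hpos.2 A) (hp.pos.2 A)⟩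
        (by simp)
    have hant (A) (hA : A ∈ substAll σ Γ₀) : PosDerivable c (p.ant ⟹ A :: p.suc) := by
      obtain ⟨B, hB, rfl⟩ := List.mem_map.1 hA
      exact (forces_iff_posDerivable hc (hpos.1 B hB) hp.pos).1
        (hp.ant B (List.mem_append_left _ hB))
    have hsuc (A) (hA : A ∈ substAll σ Δ₀) : PosDerivable c (A :: p.ant ⟹ p.suc) := by
      obtain ⟨B, hB, rfl⟩ := List.mem_map.1 hA
      exact (hp.suc B (List.mem_append_left _ hB)).posDerivable hc (hpos.2 B hB) hp.pos
    have hcons {Γ' : List Formula} (h : (Γ' ++ p.ant ⟹ substAll σ Δ₀ ++ p.suc).Positive) :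
      (Γ' ++ p.ant ⟹ p.suc).Positive := ⟨h.1, hp.pos.2⟩
    -- The instance `hd` of the axiom is cut against its antecedent, which is forced, and its
    -- succedent, which is refuted.
    refine .cut_ant hant (.cut_suc (fun A hA => (hsuc A hA).weaken ?_ ?_ (fun _ h => h)) hd)
    · exact Sequent.positive_cons_ant.2
        ⟨(Sequent.positive_cons_ant.1 (hsuc A hA).positive).1, hcons hd.positive⟩
    · exact List.cons_subset_cons _ (by simp)
  | notationInd Γ Δ t r ψ hpos hW =>
    obtain ⟨hr, hp⟩ := hp.of_ant_cons
    obtain ⟨hφ, hp⟩ := hp.of_suc_cons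
    have hB : (boundedEx t ψ).Positive := positive_boundedEx.2 hpos
    have hI (s : Term) : ((boundedEx t ψ).inst s).Positive := by
      rw [inst_eq]; exact positive_subst.2 hB
    have hrule := Rule.notationInd (c := c) p.ant p.suc (t.subst σ) (r.subst σ)
      (ψ.subst (up (up σ))) (positive_subst.2 hpos) (wFree_subst.2 hW)
    -- Each premise becomes a positive derivation of the matching premise of `hrule`, with `p` in
    -- place of the side formulas.
    have h₁ := (hps _ List.mem_cons_self).posDerivable hc
      (Γ₀ := [.W (Term.var 0)]) (by simp [Formula.Positive]) trivial (hp.shift_wk hc)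
    have h₂ := (hps (Γ ⟹ (boundedEx t ψ).inst eps :: Δ) (by simp)).posDerivable hc
      (Γ₀ := []) (by simp) (hI _) hp
    have h₃ := (hps _ (List.mem_cons_of_mem _ (List.mem_cons_of_mem _ List.mem_cons_self))
      ).posDerivable hc (Γ₀ := [.W (Term.var 0), boundedEx t ψ])
      (by simp [Formula.Positive, hB]) (positive_subst.2 hB) (hp.shift_wk hc)
    have h₄ := (hps _ (List.mem_cons_of_mem _ (List.mem_cons_of_mem _
      (List.mem_cons_of_mem _ List.mem_cons_self)))
      ).posDerivable hc (Γ₀ := [.W (Term.var 0), boundedEx t ψ])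
      (by simp [Formula.Positive, hB]) (positive_subst.2 hB) (hp.shift_wk hc)
    rw [match_eq_scons, subst_head_subst_up _ rfl] at h₃ h₄
    rw [Formula.subst, shift_app_subst_up] at h₁
    rw [inst_subst] at h₂
    rw [← boundedEx_subst, match_eq_scons, match_eq_scons] at hrule
    refine hcl (hI r) hφ ?_
    rw [inst_subst]
    -- Forcing of the atom `W r` is by definition a positive derivation of it over `p`, so it can be
    -- cut against the conclusion of the induction.
    refine .mp hr (.infer hrule ?_ ?_)
    · refine Sequent.positive_cons_ant.2 ⟨trivial, Sequent.positive_cons_suc.2 ⟨?_, hp.pos⟩⟩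
      rw [← inst_subst]
      exact positive_subst.2 (hI r)
    · simp only [List.forall_mem_cons]
      exact ⟨h₁, h₂, h₃, h₄, by simp⟩
  | monotoneInd Γ Δ t r ψ hpos hW hdisj =>
    obtain ⟨hr, hp⟩ := hp.of_ant_cons
    obtain ⟨hφ, hp⟩ := hp.of_suc_cons
    have hI (s : Term) : ((boundedEx t ψ).inst s).Positive := by
      rw [inst_eq]; exact positive_subst.2 (positive_boundedEx.2 hpos)
    have hrule := Rule.monotoneInd (c := c) p.ant p.suc (t.subst σ) (r.subst σ)
      (ψ.subst (up (up σ))) (positive_subst.2 hpos) (wFree_subst.2 hW) (disjFree_subst.2 hdisj)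
    have h₁ := (hps _ List.mem_cons_self).posDerivable hc
      (Γ₀ := [.W (Term.var 0)]) (by simp [Formula.Positive]) trivial (hp.shift_wk hc)
    have h₂ := (hps (Γ ⟹ (boundedEx t ψ).inst eps :: Δ) (by simp)).posDerivable hc
      (Γ₀ := []) (by simp) (hI _) hp
    have h₃ := (hps _ (List.mem_cons_of_mem _ (List.mem_cons_of_mem _ List.mem_cons_self))
      ).posDerivable hc (Γ₀ := [.W (Term.var 1), .W (Term.var 0), bounded t ψ])
      (by simp [Formula.Positive, positive_bounded, hpos]) (positive_monotoneStep.2 hpos)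
      -- Two renamings, one for each of the eigenvariables `a` and `b`.
      ((hp.shift_wk hc).shift_wk hc)
    rw [Formula.subst, shift_app_subst_up] at h₁
    rw [inst_subst] at h₂
    rw [← boundedEx_subst, ← bounded_subst, ← monotoneStep_subst hc] at hrule
    refine hcl (hI r) hφ ?_
    rw [inst_subst]
    refine .mp hr (.infer hrule ?_ ?_)
    · refine Sequent.positive_cons_ant.2 ⟨trivial, Sequent.positive_cons_suc.2 ⟨?_, hp.pos⟩⟩
      rw [← inst_subst]
      exact positive_subst.2 (hI r)
    · simp only [List.forall_mem_cons]
      exact ⟨h₁, h₂, h₃, by simp⟩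

/-! ### From derivations to validity and back to positive derivations. -/

theorem Derivation.valid {c : Term} (hc : c.Closed) {S : Sequent} (d : Derivation c S) :
    Valid c S := by
  induction d with
  | infer h _ ih => exact h.valid hc ih

/-- A positive sequent separates itself under the identity assignment: its antecedent is forced by
identity, and a world below it that forces a formula of its succedent is derivable by contraction.
-/
theorem Valid.posDerivable_self {c : Term} (hc : c.Closed) {S : Sequent} (h : Valid c S)
    (hS : S.Positive) : PosDerivable c S := by
  refine h Term.var S ⟨hS, fun A hA => ?_, fun A hA ρ q hq hF => ?_⟩
  · refine (forces_iff_posDerivable hc (hS.1 A hA) hS).2 (.of_mem (A := A) ?_ hA ?_)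
    · exact Sequent.positive_cons_suc.2 ⟨positive_subst.2 (hS.1 A hA), hS⟩
    · rw [A.subst_var]; exact List.mem_cons_self
  · rw [var_comp] at hF
    exact ((forces_iff_posDerivable hc (hS.2 A hA) hq.pos).1 hF).contract
      (hq.suc (List.mem_map_of_mem hA))

end APH

theorem mainTheorem6 (c : APH.Term) (hc : c.Closed) (Γ Δ : List APH.Formula)
    (hpos : (APH.Sequent.mk Γ Δ).Positive)
    (h : APH.Derivable c (APH.Sequent.mk Γ Δ)) :
    ∃ d : APH.Derivation c (APH.Sequent.mk Γ Δ),
      ∀ A : APH.Formula, d.Contains A → A.Positive :=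
  h.elim fun d => ((d.valid hc).posDerivable_self hc hpos).exists_derivation
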